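/- Notation. For complex lists $a=(a_1,\dots,a_p)$, $b=(b_1,\dots,b_q)$ and $z>0$, the Meijer G-function is $$G^{m,n}_{p,q}\left(z\,\middle|\,\begin{matrix}a_1,\dots,a_p\\ b_1,\dots,b_q\end{matrix}\right)=\frac1{2\pi i}\int_{c-i\infty}^{c+i\infty}\frac{\prod_{j\le m}\Gamma(b_j-s)\prod_{j\le n}\Gamma(1-a_j+s)}{\prod_{j>m}\Gamma(1-b_j+s)\prod_{j>n}\Gamma(a_j-s)}\,z^s\,ds ,$$ where the line $\operatorname{Re}s=c$ has the poles of the $\Gamma(b_j-s)$, $j\le m$, to its right and the poles of the $\Gamma(1-a_j+s)$, $j\le n$, to its left. For a random SNR $\gamma$ with cumulative distribution function $F_\gamma$, the average bit error probability (BEP) of BPSK is $P_{\rm be}=\mathbb E\,[Q(\sqrt{2\gamma})]$, where $Q(x)=\Pr(Z>x)$ for a standard normal $Z$. Let $m_1,m_2,\Omega>0$, and let $N_1,N_2$ be random variables (multipath fading coefficients) such that $N_j^2$ has the density $\frac{m_j^{m_j}x^{m_j-1}}{\Omega^{m_j}\Gamma(m_j)}e^{-m_jx/\Omega}$, $x>0$.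 An inverse gamma variable with shape $\alpha>1$ and scale $g>0$ has the density $\frac{g^{\alpha}}{\Gamma(\alpha)y^{\alpha+1}}e^{-g/y}$, $y>0$. (1) Double shadowing. Let $I_1,I_2$ be inverse gamma with shapes $\alpha_1,\alpha_2>1$ and scales $\overline\gamma_1,\overline\gamma_2>0$, let $N_1,N_2,I_1,I_2$ be independent, and let $\gamma=N_1^2I_1N_2^2I_2$. Put $\overline\gamma=\overline\gamma_1\overline\gamma_2$, $\tilde\gamma=\frac{m_1m_2}{\Omega^2\overline\gamma}$ (that is, $m_1m_2/\overline\gamma$ under the normalization $\Omega=1$) and $\mathcal S_1=\frac1{\Gamma(m_1)\Gamma(m_2)\Gamma(\alpha_1)\Gamma(\alpha_2)}$. Then the integral and the G-function below converge (absolutely, the latter along every separating vertical line, of which there is at least one, and with the same value along each), and $$P_{\rm be}=\frac1{2\sqrt\pi}\int_0^\infty F_\gamma(x)\,x^{-1/2}e^{-x}\,dx=\frac{\mathcal S_1}{2\sqrt\pi}\;G^{2,4}_{4,3}\left(\tilde\gamma\,\middle|\,\begin{matrix}1-\alpha_2,\,1-\alpha_1,\,1,\,\tfrac12\\ m_1,\,m_2,\,0\end{matrix}\right).$$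 (2) Single shadowing. Let $I$ be inverse gamma with shape $\alpha>1$ and scale $\overline\gamma>0$, let $N_1,N_2,I$ be independent, and let $\gamma=(N_1N_2)^2I$. Put $\tilde\gamma=\frac{m_1m_2}{\Omega^2\overline\gamma}$ and $\mathcal S_2=\frac1{\Gamma(m_1)\Gamma(m_2)\Gamma(\alpha)}$. Then, with convergence as in (1), $$P_{\rm be}=\frac1{2\sqrt\pi}\int_0^\infty F_\gamma(x)\,x^{-1/2}e^{-x}\,dx=\frac{\mathcal S_2}{2\sqrt\pi}\;G^{2,3}_{3,3}\left(\tilde\gamma\,\middle|\,\begin{matrix}1-\alpha,\,1,\,\tfrac12\\ m_1,\,m_2,\,0\end{matrix}\right).$$ -/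

import Mathlib

open MeasureTheory ProbabilityTheory

noncomputable section

/-! ### The Meijer G-function -/

/-- The Mellin--Barnes integrand of `G^{m,n}_{p,q}(z | a₁,…,a_p ; b₁,…,b_q)`:
`∏_{j≤m} Γ(b_j - s) ∏_{j≤n} Γ(1 - a_j + s) / (∏_{j>m} Γ(1 - b_j + s) ∏_{j>n} Γ(a_j - s)) * z^s`,
where `p = a.length`, `q = b.length`. (`Complex.Gamma` is `0` at the poles of `Γ`, so that its
inverse is the entire function `1/Γ` also there.) -/
def meijerIntegrand (m n : ℕ) (a b : List ℂ) (z s : ℂ) : ℂ :=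
  ((b.take m).map fun β => Complex.Gamma (β - s)).prod
    * ((a.take n).map fun α => Complex.Gamma (1 - α + s)).prod
    / (((b.drop m).map fun β => Complex.Gamma (1 - β + s)).prod
      * ((a.drop n).map fun α => Complex.Gamma (α - s)).prod)
    * z ^ s

/-- The vertical line `Re s = c` separates the poles `b_j + k` of the `Γ(b_j - s)`, `j ≤ m`
(they lie to the right of it), from the poles `a_j - 1 - k` of the `Γ(1 - a_j + s)`, `j ≤ n`
(they lie to the left of it). -/
def MeijerSeparates (m n : ℕ) (a b : List ℂ) (c : ℝ) : Prop :=
  (∀ β ∈ b.take m, ∀ k : ℕ, c < (β + k).re) ∧ (∀ α ∈ a.take n, ∀ k : ℕ, (α - 1 - k).re < c)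

/-- `G^{m,n}_{p,q}(z | a ; b) = w` in the sense of the Mellin--Barnes integral
`(1 / 2πi) ∫ ds` along a vertical line from `c - i∞` to `c + i∞`: there is a separating vertical
line, and along every such line the integral converges absolutely and has the value `w`. -/
structure HasMeijerG (m n : ℕ) (a b : List ℂ) (z w : ℂ) : Prop where
  exists_separates : ∃ c : ℝ, MeijerSeparates m n a b c
  integrable : ∀ c : ℝ, MeijerSeparates m n a b c →
    Integrable fun t : ℝ => meijerIntegrand m n a b z (c + t * Complex.I)
  integral_eq : ∀ c : ℝ, MeijerSeparates m n a b c →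
    (1 / (2 * Real.pi) : ℂ) * ∫ t : ℝ, meijerIntegrand m n a b z (c + t * Complex.I) = w

open Classical in
/-- The Meijer G-function `G^{m,n}_{p,q}(z | a ; b)` (with value `0` where the Mellin--Barnes
integral along separating vertical lines does not define it). -/
def meijerG (m n : ℕ) (a b : List ℂ) (z : ℂ) : ℂ :=
  if h : ∃ w, HasMeijerG m n a b z w then h.choose else 0

theorem HasMeijerG.unique {m n : ℕ} {a b : List ℂ} {z w w' : ℂ}
    (h : HasMeijerG m n a b z w) (h' : HasMeijerG m n a b z w') : w = w' := by
  obtain ⟨c, hc⟩ := h.exists_separates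
  exact (h.integral_eq c hc).symm.trans (h'.integral_eq c hc)

theorem HasMeijerG.meijerG_eq {m n : ℕ} {a b : List ℂ} {z w : ℂ}
    (h : HasMeijerG m n a b z w) : meijerG m n a b z = w := by
  have hex : ∃ w, HasMeijerG m n a b z w := ⟨w, h⟩
  rw [meijerG, dif_pos hex]
  exact hex.choose_spec.unique h

/-! ### The channel model -/

/-- The law of the squared envelope `N²` under Nakagami-`m` fading with mean square value `Ω`:
density `m^m x^(m-1) / (Ω^m Γ(m)) * exp (-m x / Ω)` on `x > 0`,
which is the gamma law with shape `m` and rate `m / Ω`. -/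
def nakagamiPowerLaw (m Ω : ℝ) : Measure ℝ := gammaMeasure m (m / Ω)

/-- The density of the inverse gamma law with shape `α` and scale `g`. -/
def inverseGammaPDF (α g y : ℝ) : ℝ :=
  if 0 < y then g ^ α / (Real.Gamma α * y ^ (α + 1)) * Real.exp (-(g / y)) else 0

/-- The inverse gamma law with shape `α` and scale `g`. -/
def inverseGammaLaw (α g : ℝ) : Measure ℝ :=
  volume.withDensity fun y => ENNReal.ofReal (inverseGammaPDF α g y)

/-- The double-shadowing scenario: independent Nakagami envelopes `N₁, N₂` and inverse gamma
shadowing coefficients `I₁, I₂`. -/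
structure DoubleShadowing {W : Type*} [MeasurableSpace W] (P : Measure W)
    (N₁ N₂ I₁ I₂ : W → ℝ) (m₁ m₂ Ω α₁ α₂ g₁ g₂ : ℝ) : Prop where
  aemeasurable_N₁ : AEMeasurable N₁ P
  aemeasurable_N₂ : AEMeasurable N₂ P
  law_N₁ : HasLaw (fun w => N₁ w ^ 2) (nakagamiPowerLaw m₁ Ω) P
  law_N₂ : HasLaw (fun w => N₂ w ^ 2) (nakagamiPowerLaw m₂ Ω) P
  law_I₁ : HasLaw I₁ (inverseGammaLaw α₁ g₁) P
  law_I₂ : HasLaw I₂ (inverseGammaLaw α₂ g₂) P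
  indep : iIndepFun ![N₁, N₂, I₁, I₂] P

/-- The single-shadowing scenario: independent Nakagami envelopes `N₁, N₂` and one inverse gamma
shadowing coefficient `I`. -/
structure SingleShadowing {W : Type*} [MeasurableSpace W] (P : Measure W)
    (N₁ N₂ I : W → ℝ) (m₁ m₂ Ω α g : ℝ) : Prop where
  aemeasurable_N₁ : AEMeasurable N₁ P
  aemeasurable_N₂ : AEMeasurable N₂ P
  law_N₁ : HasLaw (fun w => N₁ w ^ 2) (nakagamiPowerLaw m₁ Ω) P
  law_N₂ : HasLaw (fun w => N₂ w ^ 2) (nakagamiPowerLaw m₂ Ω) P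
  law_I : HasLaw I (inverseGammaLaw α g) P
  indep : iIndepFun ![N₁, N₂, I] P

/-- The received SNR in the double-shadowing scenario. -/
def snrDS {W : Type*} (N₁ N₂ I₁ I₂ : W → ℝ) (w : W) : ℝ :=
  (N₁ w ^ 2 * I₁ w) * (N₂ w ^ 2 * I₂ w)

/-- The received SNR in the single-shadowing scenario. -/
def snrSS {W : Type*} (N₁ N₂ I : W → ℝ) (w : W) : ℝ :=
  (N₁ w * N₂ w) ^ 2 * I w

/-! ### Bit error probability of BPSK -/

/-- The Gaussian tail probability `Q(x) = Pr(Z > x)`, `Z` standard normal. -/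
def gaussianQ (x : ℝ) : ℝ := (gaussianReal 0 1).real (Set.Ioi x)

/-- The average bit error probability of (coherent) BPSK over a fading channel with random
instantaneous SNR `γ`: the mean of the conditional error probability `Q(√(2γ))`. -/
def bepBPSK {W : Type*} [MeasurableSpace W] (P : Measure W) (γ : W → ℝ) : ℝ :=
  ∫ w, gaussianQ (Real.sqrt (2 * γ w)) ∂P

/-- The integrand `F(x) x^(-1/2) e^(-x)` of the CDF form of the BPSK bit error probability, where
`F` is the cumulative distribution function of `γ`. -/
def bepIntegrand {W : Type*} [MeasurableSpace W] (P : Measure W) (γ : W → ℝ) (x : ℝ) : ℝ :=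
  cdf (P.map γ) x * x ^ (-(1 / 2) : ℝ) * Real.exp (-x)

end

/-! The proof is Mellin inversion combined with the multiplicativity of moments. For `y ≥ 0` the
substitution `x = √(2u)` gives `Q(√(2y)) = Γ(1/2, y) / (2√π)`, so the error probability is `E[Γ(1/2,
γ)] / (2√π)`. Writing `F_γ(x) = E[1_{γ ≤ x}]` and applying Fubini turns the CDF integral into the
same expectation.

The Mellin transform of `Γ(1/2, ·)` is `Γ(s + 1/2) / s` on `Re s > 0`, hence `Γ(1/2, y)` is the
inverse Mellin integral of `Γ(s + 1/2) / s * y^(-s)` (`integral_Gamma_add_half_div_mul_cpow`). Put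
`y = γ` and take expectations under the integral sign (`mellinBarnes_halfGammaTail`): the integrand
becomes `Γ(s + 1/2) / s * E[γ^(-s)]`. By independence `E[γ^(-s)]` is a product of one-variable
moments: a Nakagami power contributes `Γ(m - s)`, an inverse gamma variable `Γ(α + s)`, and the
scales combine to `z^s`. With `1 / s = Γ(s) / Γ(1 + s)` this is the Meijer integrand up to a
constant.

The separating lines are exactly `0 < c < min(m₁, m₂)`, where all these moments exist. The argument
applies on each of them and always yields the same expectation, so no contour shift is needed. Nor
is Stirling's formula: `|E[γ^(-s)]| ≤ E[γ^(-c)]`, and `Γ(s + 1/2) / s` alone provides integrability.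
-/

noncomputable section

open Set Complex

/-! ### Mellin transform and inversion for the incomplete gamma function -/

/-- The kernel `x^(-1/2) e^(-x)` of the incomplete gamma function `Γ(1/2, ·)`. -/
def halfGammaKernel (x : ℝ) : ℝ := x ^ (-(1 / 2) : ℝ) * Real.exp (-x)

/-- The upper incomplete gamma function `Γ(1/2, y)`. -/
def halfGammaTail (y : ℝ) : ℝ := ∫ x in Ioi y, halfGammaKernel x

theorem measurable_halfGammaKernel : Measurable halfGammaKernel := by
  unfold halfGammaKernel; fun_prop

theorem integrableOn_rpow_mul_halfGammaKernel {σ : ℝ} (hσ : 0 ≤ σ) :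
    IntegrableOn (fun x => x ^ σ * halfGammaKernel x) (Ioi 0) := by
  refine (Real.GammaIntegral_convergent (s := σ + 1 / 2) (by linarith)).congr_fun
    (fun x hx => ?_) measurableSet_Ioi
  have hx : 0 < x := hx
  simp only [halfGammaKernel]
  rw [← mul_assoc, ← Real.rpow_add hx, mul_comm]
  ring_nf

theorem integrableOn_halfGammaKernel : IntegrableOn halfGammaKernel (Ioi 0) := by
  simpa using integrableOn_rpow_mul_halfGammaKernel le_rfl

theorem halfGammaKernel_nonneg {x : ℝ} (hx : 0 < x) : 0 ≤ halfGammaKernel x := by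
  unfold halfGammaKernel; positivity

theorem integral_cpow_mul_halfGammaKernel {s : ℂ} (hs : 0 < s.re) :
    ∫ x in Ioi (0 : ℝ), (x : ℂ) ^ s * (halfGammaKernel x : ℂ) = Gamma (s + 1 / 2) := by
  rw [Gamma_eq_integral (by simp; linarith), GammaIntegral]
  refine setIntegral_congr_fun measurableSet_Ioi fun x hx => ?_
  have hx : 0 < x := hx
  have hx' : (x : ℂ) ≠ 0 := by exact_mod_cast hx.ne'
  simp only [halfGammaKernel]
  push_cast
  rw [show s + 1 / 2 - 1 = s + (-(1 / 2) : ℝ) by push_cast; ring, cpow_add _ _ hx',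
    ofReal_cpow hx.le]
  push_cast
  ring

theorem integrableOn_Ioo_cpow {s : ℂ} (hs : 0 < s.re) {x : ℝ} (hx : 0 < x) :
    IntegrableOn (fun y : ℝ => (y : ℂ) ^ (s - 1)) (Ioo 0 x) := by
  have := intervalIntegral.intervalIntegrable_cpow' (a := 0) (b := x) (r := s - 1)
    (by simp; linarith)
  rw [intervalIntegrable_iff_integrableOn_Ioo_of_le hx.le] at this
  exact this

theorem integral_Ioo_cpow {s : ℂ} (hs : 0 < s.re) {x : ℝ} (hx : 0 < x) :
    ∫ y in Ioo 0 x, (y : ℂ) ^ (s - 1) = (x : ℂ) ^ s / s := by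
  have hs0 : s ≠ 0 := by rintro rfl; simp at hs
  rw [← integral_Ioc_eq_integral_Ioo, ← intervalIntegral.integral_of_le hx.le,
    integral_cpow (Or.inl (by simp; linarith))]
  simp [zero_cpow hs0]

theorem integral_Ioo_norm_cpow {s : ℂ} (hs : 0 < s.re) {x : ℝ} (hx : 0 < x) :
    ∫ y in Ioo 0 x, ‖(y : ℂ) ^ (s - 1)‖ = x ^ s.re / s.re := by
  rw [setIntegral_congr_fun (g := fun y : ℝ => y ^ (s.re - 1)) measurableSet_Ioo
    (fun y hy => by simp only [norm_cpow_eq_rpow_re_of_pos hy.1, sub_re, one_re]),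
    ← integral_Ioc_eq_integral_Ioo, ← intervalIntegral.integral_of_le hx.le,
    integral_rpow (Or.inl (by linarith))]
  simp [Real.zero_rpow hs.ne']

/-- Fubini on the region `0 < y < x`: integrating `y^(s-1)` over `(0, x)` first gives `x^s / s`, and
the remaining integral in `x` is Euler's integral for `Γ(s + 1/2)`. -/
theorem hasMellin_halfGammaTail {s : ℂ} (hs : 0 < s.re) :
    HasMellin (fun y => (halfGammaTail y : ℂ)) s (Gamma (s + 1 / 2) / s) := by
  let H : ℝ × ℝ → ℂ := fun p =>
    (p.1 : ℂ) ^ (s - 1) * {q : ℝ × ℝ | q.1 < q.2}.indicator (fun q => (halfGammaKernel q.2 : ℂ)) p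
  have hmeas : Measurable H := by
    refine Measurable.mul (by fun_prop) (Measurable.indicator ?_ ?_)
    · exact (measurable_ofReal.comp measurable_halfGammaKernel).comp measurable_snd
    · exact measurableSet_lt measurable_fst measurable_snd
  have hslice : ∀ x : ℝ, (fun y => H (y, x)) =
      (Iio x).indicator fun y => (y : ℂ) ^ (s - 1) * (halfGammaKernel x : ℂ) := by
    intro x
    ext y
    by_cases h : y < x <;> simp [H, h]
  have hInt : Integrable H ((volume.restrict (Ioi 0)).prod (volume.restrict (Ioi 0))) := by
    rw [integrable_prod_iff' hmeas.aestronglyMeasurable]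
    constructor
    · filter_upwards [ae_restrict_mem measurableSet_Ioi] with x hx
      rw [hslice, integrable_indicator_iff measurableSet_Iio, IntegrableOn,
        Measure.restrict_restrict measurableSet_Iio, inter_comm, Ioi_inter_Iio]
      exact (integrableOn_Ioo_cpow hs hx).mul_const _
    · refine IntegrableOn.congr_fun
        (Integrable.div_const (integrableOn_rpow_mul_halfGammaKernel hs.le) s.re)
        (fun x hx => ?_) measurableSet_Ioi
      have : (fun y => ‖H (y, x)‖) =
          (Iio x).indicator fun y => ‖(y : ℂ) ^ (s - 1)‖ * halfGammaKernel x := by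
        ext y
        by_cases h : y < x <;> simp [H, h, abs_of_nonneg (halfGammaKernel_nonneg hx)]
      simp only [this]
      rw [integral_indicator measurableSet_Iio, Measure.restrict_restrict measurableSet_Iio,
        inter_comm, Ioi_inter_Iio, integral_mul_const, integral_Ioo_norm_cpow hs hx]
      ring
  have hfst : ∀ y ∈ Ioi (0 : ℝ), ∫ x in Ioi 0, H (y, x) =
      (y : ℂ) ^ (s - 1) • (halfGammaTail y : ℂ) := by
    intro y hy
    have : (fun x => H (y, x)) =
        (Ioi y).indicator fun x => (y : ℂ) ^ (s - 1) * (halfGammaKernel x : ℂ) := by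
      ext x
      by_cases h : y < x <;> simp [H, h]
    rw [this, integral_indicator measurableSet_Ioi, Measure.restrict_restrict measurableSet_Ioi,
      inter_eq_left.2 (Ioi_subset_Ioi (le_of_lt hy)), integral_const_mul, integral_complex_ofReal]
    rfl
  refine ⟨IntegrableOn.congr_fun (hInt.integral_prod_left) hfst measurableSet_Ioi, ?_⟩
  rw [mellin, ← setIntegral_congr_fun measurableSet_Ioi hfst,
    integral_integral_swap (f := fun y x => H (y, x)) hInt,
    ← integral_cpow_mul_halfGammaKernel hs, ← integral_div]
  refine setIntegral_congr_fun measurableSet_Ioi fun x hx => ?_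
  simp only [hslice]
  rw [integral_indicator measurableSet_Iio, Measure.restrict_restrict measurableSet_Iio,
    inter_comm, Ioi_inter_Iio, integral_mul_const, integral_Ioo_cpow hs hx]
  ring

/-- Pointwise Mellin inversion requires continuity at the point. Near `y` the tail is a constant
minus an integral with variable upper endpoint. -/
theorem continuousAt_halfGammaTail {y : ℝ} (hy : 0 < y) : ContinuousAt halfGammaTail y := by
  have h0 : IntegrableOn halfGammaKernel (Ioi (y / 2)) :=
    integrableOn_halfGammaKernel.mono_set (Ioi_subset_Ioi (by linarith))
  have hcont : ContinuousAt halfGammaKernel y := by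
    unfold halfGammaKernel
    exact (Real.continuousAt_rpow_const _ _ (Or.inl hy.ne')).mul (by fun_prop)
  have key : ∀ z ∈ Ioi (y / 2), halfGammaTail z =
      halfGammaTail (y / 2) - ∫ x in (y / 2)..z, halfGammaKernel x := by
    intro z hz
    have hz : y / 2 < z := hz
    have := intervalIntegral.integral_interval_add_Ioi' (a := y / 2) (b := z)
      ((intervalIntegrable_iff_integrableOn_Ioc_of_le hz.le).2 (h0.mono_set Ioc_subset_Ioi_self))
      (h0.mono_set (Ioi_subset_Ioi hz.le))
    simp only [halfGammaTail]
    linarith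
  have hc : ContinuousAt (fun z => halfGammaTail (y / 2) - ∫ x in (y / 2)..z, halfGammaKernel x)
      y := by
    refine continuousAt_const.sub (HasDerivAt.continuousAt (f' := halfGammaKernel y) ?_)
    refine intervalIntegral.integral_hasDerivAt_right ?_
      measurable_halfGammaKernel.stronglyMeasurable.stronglyMeasurableAtFilter hcont
    exact (intervalIntegrable_iff_integrableOn_Ioc_of_le (by linarith)).2
      (h0.mono_set Ioc_subset_Ioi_self)
  refine hc.congr ?_
  filter_upwards [Ioi_mem_nhds (show y / 2 < y by linarith)] with z hz using (key z hz).symm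

theorem norm_Gamma_le_Gamma_re {s : ℂ} (hs : 0 < s.re) : ‖Gamma s‖ ≤ Real.Gamma s.re := by
  rw [Gamma_eq_integral hs, Real.Gamma_eq_integral hs, GammaIntegral]
  refine (norm_integral_le_integral_norm _).trans_eq
    (setIntegral_congr_fun measurableSet_Ioi fun x hx => ?_)
  simp only [norm_mul, norm_cpow_eq_rpow_re_of_pos hx, sub_re, one_re, norm_real, Real.norm_eq_abs,
    Real.abs_exp]

theorem continuous_Gamma_vertical {σ : ℝ} (hσ : 0 < σ) :
    Continuous fun t : ℝ => Gamma (σ + t * I) := by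
  refine continuous_iff_continuousAt.2 fun t => ?_
  have h : DifferentiableAt ℂ Gamma (σ + t * I) := by
    refine differentiableAt_Gamma _ fun m hm => ?_
    have := congrArg re hm
    simp at this
    have h2 : (0 : ℝ) ≤ m := m.cast_nonneg
    linarith
  exact ContinuousAt.comp (g := Gamma) (f := fun t : ℝ => (σ + t * I : ℂ)) h.continuousAt
    (by fun_prop)

/-- One use of the functional equation suffices: `|Γ(s + 1/2)| = |Γ(s + 3/2)| / |s + 1/2| ≤ Γ(σ +
3/2) / |s|`, so the quotient is at most `Γ(σ + 3/2) / |s|²`, and `|s|² ≥ min(σ², 1) (1 + t²)`. -/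
theorem verticalIntegrable_Gamma_add_half_div {σ : ℝ} (hσ : 0 < σ) :
    VerticalIntegrable (fun s => Gamma (s + 1 / 2) / s) σ := by
  have hne : ∀ t : ℝ, (σ + t * I : ℂ) ≠ 0 := by
    intro t h
    have := congrArg re h
    simp at this
    linarith
  have hg : Continuous fun t : ℝ => Gamma (σ + t * I + 1 / 2) := by
    convert continuous_Gamma_vertical (σ := σ + 1 / 2) (by linarith) using 3
    push_cast; ring
  unfold VerticalIntegrable
  set C := Real.Gamma (σ + 3 / 2) / min (σ ^ 2) 1 with hC
  have hmin : 0 < min (σ ^ 2) 1 := lt_min (by positivity) one_pos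
  have hG : 0 < Real.Gamma (σ + 3 / 2) := Real.Gamma_pos_of_pos (by linarith)
  refine (integrable_inv_one_add_sq.const_mul C).mono'
    (hg.div (by fun_prop) hne).aestronglyMeasurable (.of_forall fun t => ?_)
  have h1 : (σ + t * I + 1 / 2 : ℂ) ≠ 0 := by
    intro h
    have := congrArg re h
    simp at this
    linarith
  have h2 := Gamma_add_one _ h1
  have h3 : ‖Gamma (σ + t * I + 1 / 2 + 1)‖ ≤ Real.Gamma (σ + 3 / 2) := by
    refine (norm_Gamma_le_Gamma_re (by simp; linarith)).trans_eq ?_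
    congr 1
    simp
    ring
  rw [h2, norm_mul] at h3
  have hs : ‖(σ + t * I : ℂ)‖ = √(σ ^ 2 + t ^ 2) := norm_add_mul_I σ t
  have hs2 : ‖(σ + t * I : ℂ)‖ ≤ ‖(σ + t * I + 1 / 2 : ℂ)‖ := by
    have : (σ + t * I + 1 / 2 : ℂ) = ((σ + 1 / 2 : ℝ) : ℂ) + t * I := by push_cast; ring
    rw [this, hs, norm_add_mul_I]
    exact Real.sqrt_le_sqrt (by nlinarith)
  have hpos : 0 < ‖(σ + t * I : ℂ)‖ := norm_pos_iff.2 (hne t)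
  have hsq : ‖(σ + t * I : ℂ)‖ ^ 2 = σ ^ 2 + t ^ 2 := by
    rw [hs, Real.sq_sqrt (by positivity)]
  have hlow : min (σ ^ 2) 1 * (1 + t ^ 2) ≤ ‖(σ + t * I : ℂ)‖ ^ 2 := by
    rw [hsq]
    nlinarith [min_le_left (σ ^ 2) 1, min_le_right (σ ^ 2) 1, sq_nonneg t]
  rw [norm_div, hC, ← div_eq_mul_inv, div_div, div_le_div_iff₀ hpos (by positivity)]
  set n := ‖(σ + t * I : ℂ)‖
  have : ‖Gamma (σ + t * I + 1 / 2)‖ * n ≤ Real.Gamma (σ + 3 / 2) :=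
    le_trans (by rw [mul_comm]; gcongr) h3
  calc _ ≤ ‖Gamma (σ + t * I + 1 / 2)‖ * n ^ 2 := by gcongr
    _ = (‖Gamma (σ + t * I + 1 / 2)‖ * n) * n := by ring
    _ ≤ _ := by gcongr

/-- The Mellin inversion formula for the incomplete gamma function `Γ(1/2, ·)`. -/
theorem integral_Gamma_add_half_div_mul_cpow {c y : ℝ} (hc : 0 < c) (hy : 0 < y) :
    (1 / (2 * Real.pi) : ℂ) * ∫ t : ℝ, Gamma (c + t * I + 1 / 2) / (c + t * I)
      * (y : ℂ) ^ (-(c + t * I)) = halfGammaTail y := by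
  have hre : 0 < (c : ℂ).re := by simpa using hc
  have hmel : ∀ t : ℝ, mellin (fun y => (halfGammaTail y : ℂ)) (c + t * I) =
      Gamma (c + t * I + 1 / 2) / (c + t * I) :=
    fun t => (hasMellin_halfGammaTail (by simpa using hc)).2
  have hv : VerticalIntegrable (mellin fun y => (halfGammaTail y : ℂ)) c := by
    have := verticalIntegrable_Gamma_add_half_div hc
    unfold VerticalIntegrable at this ⊢
    simpa only [hmel] using this
  have := mellinInv_mellin_eq c (fun y => (halfGammaTail y : ℂ)) hy
    (hasMellin_halfGammaTail hre).1 hv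
    (continuous_ofReal.continuousAt.comp (continuousAt_halfGammaTail hy))
  rw [← this, mellinInv]
  simp only [hmel, smul_eq_mul, real_smul]
  push_cast
  simp only [mul_comm]

/-! ### Complex moments of positive random variables -/

/-- `E[X^s] = M` for a positive random variable `X`, with absolute convergence. -/
structure HasComplexMoment {W : Type*} [MeasurableSpace W] (P : Measure W) (X : W → ℝ)
    (s M : ℂ) : Prop where
  integrable : Integrable (fun w => (X w : ℂ) ^ s) P
  integral_eq : ∫ w, (X w : ℂ) ^ s ∂P = M

section
variable {W : Type*} [MeasurableSpace W] {P : Measure W}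

/-- Positivity is what makes `(XY)^s = X^s Y^s` hold for the principal branch; independence then
factors the expectation. -/
theorem HasComplexMoment.mul {X Y : W → ℝ} {s M N : ℂ} (hX : HasComplexMoment P X s M)
    (hY : HasComplexMoment P Y s N) (hX0 : ∀ᵐ w ∂P, 0 < X w) (hY0 : ∀ᵐ w ∂P, 0 < Y w)
    (hXY : IndepFun X Y P) : HasComplexMoment P (X * Y) s (M * N) := by
  have hm : Measurable fun x : ℝ => (x : ℂ) ^ s := by fun_prop
  have hind : IndepFun (fun w => (X w : ℂ) ^ s) (fun w => (Y w : ℂ) ^ s) P := hXY.comp hm hm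
  have hae : (fun w => (X w : ℂ) ^ s) * (fun w => (Y w : ℂ) ^ s) =ᵐ[P]
      fun w => (((X * Y) w : ℝ) : ℂ) ^ s := by
    filter_upwards [hX0, hY0] with w h1 h2
    simp only [Pi.mul_apply, ofReal_mul]
    rw [mul_cpow_ofReal_nonneg h1.le h2.le]
  refine ⟨(hind.integrable_mul hX.integrable hY.integrable).congr hae, ?_⟩
  rw [← integral_congr_ae hae, hind.integral_mul_eq_mul_integral hX.integrable.1 hY.integrable.1,
    hX.integral_eq, hY.integral_eq]

theorem HasComplexMoment.congr {X Y : W → ℝ} {s M N : ℂ} (hX : HasComplexMoment P X s M)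
    (h : X = Y) (h' : M = N) : HasComplexMoment P Y s N := h ▸ h' ▸ hX

/-- The moment of order `s` is the Mellin transform of the density at `s + 1`. The value of the
density at `0` is irrelevant, being on a null set. -/
theorem HasComplexMoment.of_hasLaw {X : W → ℝ} {p : ℝ → ℝ} (hp : Measurable p)
    (hp0 : ∀ x, 0 ≤ p x) (hpn : ∀ x < 0, p x = 0)
    (hX : HasLaw X (volume.withDensity fun x => ENNReal.ofReal (p x)) P) {s M : ℂ}
    (h : HasMellin (fun x => (p x : ℂ)) (s + 1) M) : HasComplexMoment P X s M := by
  have hm : Measurable fun x : ℝ => (x : ℂ) ^ s := by fun_prop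
  have hpm : Measurable fun x => ENNReal.ofReal (p x) := hp.ennreal_ofReal
  have heq : ∀ x : ℝ, (ENNReal.ofReal (p x)).toReal • (x : ℂ) ^ s =
      (x : ℂ) ^ (s + 1 - 1) • (p x : ℂ) := by
    intro x
    rw [ENNReal.toReal_ofReal (hp0 x), real_smul, add_sub_cancel_right, smul_eq_mul, mul_comm]
  have hsupp : (Ioi (0 : ℝ)).indicator (fun x : ℝ => (x : ℂ) ^ (s + 1 - 1) • (p x : ℂ)) =ᵐ[volume]
      fun x : ℝ => (x : ℂ) ^ (s + 1 - 1) • (p x : ℂ) := by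
    have : ∀ᵐ x : ℝ, x ≠ 0 := by simp [ae_iff]
    filter_upwards [this] with x hx
    rcases lt_or_gt_of_ne hx with h | h
    · simp [hpn x h]
    · simp [h]
  have hint : Integrable fun x : ℝ => (x : ℂ) ^ (s + 1 - 1) • (p x : ℂ) :=
    ((integrable_indicator_iff measurableSet_Ioi).2 h.1).congr hsupp
  constructor
  · refine Integrable.comp_aemeasurable (g := fun x : ℝ => (x : ℂ) ^ s) ?_ hX.aemeasurable
    rw [hX.map_eq, integrable_withDensity_iff_integrable_smul' hpm (by simp)]
    simpa only [heq] using hint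
  · have := hX.integral_comp (f := fun x : ℝ => (x : ℂ) ^ s) hm.aestronglyMeasurable
    rw [Function.comp_def] at this
    rw [this, integral_withDensity_eq_integral_toReal_smul hpm (by simp)]
    simp only [heq]
    rw [← integral_congr_ae hsupp, integral_indicator measurableSet_Ioi]
    exact h.2

theorem ae_pos_of_hasLaw {X : W → ℝ} {p : ℝ → ℝ} (hp : Measurable p) (hpn : ∀ x < 0, p x = 0)
    (hX : HasLaw X (volume.withDensity fun x => ENNReal.ofReal (p x)) P) :
    ∀ᵐ w ∂P, 0 < X w := by
  rw [hX.ae_iff (p := fun x => 0 < x) (measurableSet_Ioi (a := (0 : ℝ))).mem,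
    ae_withDensity_iff hp.ennreal_ofReal]
  have : ∀ᵐ x : ℝ, x ≠ 0 := by simp [ae_iff]
  filter_upwards [this] with x hx h
  rcases lt_or_gt_of_ne hx with h' | h'
  · simp [hpn x h'] at h
  · exact h'

end

/-! ### Moments of the gamma and inverse gamma laws -/

theorem hasMellin_rpow_mul_exp {a r : ℝ} (hr : 0 < r) {s : ℂ} (hs : 0 < a + s.re) :
    HasMellin (fun x => ((x ^ a * Real.exp (-(r * x)) : ℝ) : ℂ)) s
      (Gamma (a + s) * (r : ℂ) ^ (-(a + s))) := by
  have hre : 0 < (a + s : ℂ).re := by simpa using hs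
  have heq : ∀ x ∈ Ioi (0 : ℝ), (x : ℂ) ^ ((a + s : ℂ) - 1) * exp (-(r * x)) =
      (x : ℂ) ^ (s - 1) • ((x ^ a * Real.exp (-(r * x)) : ℝ) : ℂ) := by
    intro x hx
    have hx : 0 < x := hx
    have hx' : (x : ℂ) ≠ 0 := by exact_mod_cast hx.ne'
    rw [show (a + s : ℂ) - 1 = (s - 1) + a by ring, cpow_add _ _ hx', smul_eq_mul]
    push_cast
    rw [ofReal_cpow hx.le, mul_assoc]
  have hr0 : (r : ℂ) ≠ 0 := by exact_mod_cast hr.ne'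
  have hval := integral_cpow_mul_exp_neg_mul_Ioi hre hr
  have hne : (1 / r : ℂ) ^ (a + s : ℂ) * Gamma (a + s) ≠ 0 :=
    mul_ne_zero (by simp [cpow_eq_zero_iff, hr0]) (Gamma_ne_zero_of_re_pos hre)
  constructor
  · refine IntegrableOn.congr_fun ?_ heq measurableSet_Ioi
    -- A non-integrable function has Bochner integral `0`, whereas the known value of this integral
    -- is nonzero.
    by_contra h
    exact hne (hval ▸ integral_undef h)
  · rw [mellin, ← setIntegral_congr_fun measurableSet_Ioi heq, hval, mul_comm, one_div,
      cpow_neg, ← inv_cpow]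
    rw [arg_ofReal_of_nonneg hr.le]
    exact Real.pi_pos.ne

theorem HasMellin.congr {f g : ℝ → ℂ} {s m m' : ℂ} (hf : HasMellin f s m)
    (hfg : EqOn f g (Ioi 0)) (hm : m = m') : HasMellin g s m' := by
  have : EqOn (fun x : ℝ => (x : ℂ) ^ (s - 1) • f x) (fun x : ℝ => (x : ℂ) ^ (s - 1) • g x)
      (Ioi 0) := fun x hx => by simp only [hfg hx]
  refine ⟨hf.1.congr_fun this measurableSet_Ioi, ?_⟩
  rw [mellin, ← setIntegral_congr_fun measurableSet_Ioi this, ← hm]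
  exact hf.2

theorem hasMellin_const_mul {f : ℝ → ℂ} {s m : ℂ} (hf : HasMellin f s m) (c : ℂ) :
    HasMellin (fun x => c * f x) s (c * m) := by
  have := hasMellin_const_smul hf.1 c
  rw [hf.2] at this
  exact this

theorem hasMellin_comp_inv {f : ℝ → ℂ} {s m : ℂ} (hf : HasMellin f (-s) m) :
    HasMellin (fun x => f x⁻¹) s m := by
  refine ⟨?_, by rw [mellin_comp_inv]; exact hf.2⟩
  have := MellinConvergent.comp_rpow (f := f) (s := s) (a := -1) (by norm_num)
  simp only [Real.rpow_neg_one] at this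
  rw [this, ofReal_neg, ofReal_one, div_neg, div_one]
  exact hf.1

theorem hasMellin_gammaPDFReal {a r : ℝ} (hr : 0 < r) {s : ℂ} (hs : s.re < a) :
    HasMellin (fun x => (gammaPDFReal a r x : ℂ)) (-s + 1)
      (Gamma (a - s) / (Real.Gamma a : ℂ) * (r : ℂ) ^ s) := by
  have hr0 : (r : ℂ) ≠ 0 := by exact_mod_cast hr.ne'
  refine (hasMellin_const_mul (hasMellin_rpow_mul_exp (a := a - 1) hr (s := -s + 1)
    (by simp; linarith)) (r ^ a / Real.Gamma a : ℝ)).congr (fun x hx => ?_) ?_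
  · have hx : 0 < x := hx
    simp only [gammaPDFReal, if_pos hx.le]
    push_cast; ring
  · push_cast
    rw [show (a - 1 + (-s + 1) : ℂ) = a - s by ring, ofReal_cpow hr.le, neg_sub,
      cpow_sub _ _ hr0]
    have : (r : ℂ) ^ (a : ℂ) ≠ 0 := by simp [cpow_eq_zero_iff, hr0]
    field_simp

/-- Under `x ↦ x⁻¹` the density becomes a multiple of `x^(α+1) e^(-gx)`, and the Mellin argument
changes sign. -/
theorem hasMellin_inverseGammaPDF {α g : ℝ} (hg : 0 < g) {s : ℂ} (hs : -α < s.re) :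
    HasMellin (fun x => (inverseGammaPDF α g x : ℂ)) (-s + 1)
      (Gamma (α + s) / (Real.Gamma α : ℂ) * ((g⁻¹ : ℝ) : ℂ) ^ s) := by
  have hg0 : (g : ℂ) ≠ 0 := by exact_mod_cast hg.ne'
  refine (hasMellin_const_mul (hasMellin_comp_inv (hasMellin_rpow_mul_exp (a := α + 1) hg
    (s := -(-s + 1)) (by simp; linarith))) (g ^ α / Real.Gamma α : ℝ)).congr (fun x hx => ?_) ?_
  · have hx : 0 < x := hx
    simp only [inverseGammaPDF, if_pos hx]
    rw [Real.inv_rpow hx.le, ← div_eq_mul_inv]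
    push_cast
    field_simp
  · push_cast
    rw [show (α + 1 + -(-s + 1) : ℂ) = α + s by ring, ofReal_cpow hg.le, neg_add,
      cpow_add _ _ hg0, cpow_neg, cpow_neg, inv_cpow]
    · have : (g : ℂ) ^ (α : ℂ) ≠ 0 := by simp [cpow_eq_zero_iff, hg0]
      field_simp
    · rw [arg_ofReal_of_nonneg hg.le]
      exact Real.pi_pos.ne

theorem inverseGammaPDF_nonneg {α g : ℝ} (hα : 0 < α) (hg : 0 < g) (x : ℝ) :
    0 ≤ inverseGammaPDF α g x := by
  unfold inverseGammaPDF
  split_ifs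
  · have := Real.Gamma_pos_of_pos hα
    positivity
  · rfl

theorem measurable_inverseGammaPDF (α g : ℝ) : Measurable (inverseGammaPDF α g) :=
  Measurable.ite measurableSet_Ioi (by fun_prop) measurable_const

section
variable {W : Type*} [MeasurableSpace W] {P : Measure W}

theorem hasComplexMoment_nakagamiPowerLaw {X : W → ℝ} {m Ω : ℝ} (hm : 0 < m) (hΩ : 0 < Ω)
    (hX : HasLaw X (nakagamiPowerLaw m Ω) P) {s : ℂ} (hs : s.re < m) :
    HasComplexMoment P X (-s) (Gamma (m - s) / (Real.Gamma m : ℂ) * ((m / Ω : ℝ) : ℂ) ^ s) :=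
  .of_hasLaw (measurable_gammaPDFReal _ _) (gammaPDFReal_nonneg hm (div_pos hm hΩ))
    (fun x hx => by simp [gammaPDFReal, hx.not_ge]) hX (hasMellin_gammaPDFReal (div_pos hm hΩ) hs)

theorem hasComplexMoment_inverseGammaLaw {X : W → ℝ} {α g : ℝ} (hα : 0 < α) (hg : 0 < g)
    (hX : HasLaw X (inverseGammaLaw α g) P) {s : ℂ} (hs : -α < s.re) :
    HasComplexMoment P X (-s) (Gamma (α + s) / (Real.Gamma α : ℂ) * ((g⁻¹ : ℝ) : ℂ) ^ s) :=
  .of_hasLaw (measurable_inverseGammaPDF _ _) (inverseGammaPDF_nonneg hα hg)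
    (fun x hx => by simp [inverseGammaPDF, hx.not_gt]) hX (hasMellin_inverseGammaPDF hg hs)

theorem ae_pos_of_nakagamiPowerLaw {X : W → ℝ} {m Ω : ℝ}
    (hX : HasLaw X (nakagamiPowerLaw m Ω) P) : ∀ᵐ w ∂P, 0 < X w :=
  ae_pos_of_hasLaw (measurable_gammaPDFReal _ _)
    (fun x hx => by simp [gammaPDFReal, hx.not_ge]) hX

theorem ae_pos_of_inverseGammaLaw {X : W → ℝ} {α g : ℝ}
    (hX : HasLaw X (inverseGammaLaw α g) P) : ∀ᵐ w ∂P, 0 < X w :=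
  ae_pos_of_hasLaw (measurable_inverseGammaPDF _ _)
    (fun x hx => by simp [inverseGammaPDF, hx.not_gt]) hX

end

/-! ### The Gaussian tail and the CDF form of the error probability -/

/-- The standard Gaussian tail as an incomplete gamma function. -/
theorem gaussianQ_sqrt_two_mul {y : ℝ} (hy : 0 ≤ y) :
    gaussianQ (√(2 * y)) = (2 * √Real.pi)⁻¹ * halfGammaTail y := by
  have himg : (fun u : ℝ => √(2 * u)) '' Ioi y = Ioi (√(2 * y)) := by
    ext x
    constructor
    · rintro ⟨u, hu, rfl⟩
      have hu : y < u := hu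
      exact Real.sqrt_lt_sqrt (by positivity) (by linarith)
    · intro hx
      have hx0 : 0 < x := (Real.sqrt_nonneg _).trans_lt hx
      refine ⟨x ^ 2 / 2, ?_, ?_⟩
      · have := (Real.sqrt_lt' hx0).1 hx
        simp only [mem_Ioi]
        linarith
      · simp only [mul_div_cancel₀ (x ^ 2) (two_ne_zero' ℝ)]
        exact Real.sqrt_sq hx0.le
  have hinj : InjOn (fun u : ℝ => √(2 * u)) (Ioi y) := by
    intro u hu v hv huv
    have hu : y < u := hu
    have hv : y < v := hv
    have := (Real.sqrt_inj (by linarith) (by linarith)).1 huv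
    linarith
  have hderiv : ∀ u ∈ Ioi y, HasDerivWithinAt (fun u : ℝ => √(2 * u)) (2 * 1 / (2 * √(2 * u)))
      (Ioi y) u := by
    intro u hu
    have hu : y < u := hu
    exact (((hasDerivAt_id u).const_mul 2).sqrt (by simp only [id]; linarith)).hasDerivWithinAt
  rw [gaussianQ, measureReal_def, gaussianReal_apply_eq_integral _ one_ne_zero,
    ENNReal.toReal_ofReal (integral_nonneg fun x => gaussianPDFReal_nonneg _ _ _), ← himg,
    integral_image_eq_integral_abs_deriv_smul measurableSet_Ioi hderiv hinj, halfGammaTail,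
    ← integral_const_mul]
  refine setIntegral_congr_fun measurableSet_Ioi fun u hu => ?_
  have hu : 0 < u := hy.trans_lt hu
  simp only [gaussianPDFReal, halfGammaKernel, smul_eq_mul, NNReal.coe_one, sub_zero, mul_one]
  rw [abs_of_pos (by positivity), Real.sq_sqrt (by positivity), Real.rpow_neg hu.le,
    ← Real.sqrt_eq_rpow, Real.sqrt_mul two_pos.le, Real.sqrt_mul two_pos.le,
    show -(2 * u) / 2 = -u by ring]
  have h2 : √(2 : ℝ) * √2 = 2 := Real.mul_self_sqrt two_pos.le
  have : √u ≠ 0 := by positivity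
  have : √Real.pi ≠ 0 := by positivity
  field_simp
  linear_combination -h2

section
variable {W : Type*} [MeasurableSpace W] {P : Measure W} [IsProbabilityMeasure P] {γ : W → ℝ}

theorem integrableOn_bepIntegrand (hγ : AEMeasurable γ P) :
    IntegrableOn (bepIntegrand P γ) (Ioi 0) := by
  have := Measure.isProbabilityMeasure_map hγ
  refine Integrable.mono' integrableOn_halfGammaKernel ?_ ?_
  · refine Measurable.aestronglyMeasurable ?_
    unfold bepIntegrand
    have := (monotone_cdf (P.map γ)).measurable
    fun_prop
  · filter_upwards [ae_restrict_mem measurableSet_Ioi] with x hx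
    have h := halfGammaKernel_nonneg hx
    rw [bepIntegrand, mul_assoc, ← halfGammaKernel, norm_mul, Real.norm_of_nonneg h,
      Real.norm_of_nonneg (cdf_nonneg _ _)]
    exact mul_le_of_le_one_left h (cdf_le_one _ _)

/-- Fubini for `1_{γ(w) ≤ x}` times the kernel: integrating over `w` first produces the CDF,
integrating over `x` first produces the tail from `γ(w)`. -/
theorem integral_bepIntegrand (hγ : AEMeasurable γ P) (hpos : ∀ᵐ w ∂P, 0 < γ w) :
    ∫ x in Ioi 0, bepIntegrand P γ x = ∫ w, halfGammaTail (γ w) ∂P := by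
  have := Measure.isProbabilityMeasure_map hγ
  let H : ℝ × W → ℝ := fun p =>
    {q : ℝ × W | γ q.2 ≤ q.1}.indicator (fun q => halfGammaKernel q.1) p
  have hset : NullMeasurableSet {q : ℝ × W | γ q.2 ≤ q.1} ((volume.restrict (Ioi 0)).prod P) :=
    nullMeasurableSet_le hγ.comp_snd measurable_fst.aemeasurable
  have hInt : Integrable H ((volume.restrict (Ioi 0)).prod P) := by
    refine Integrable.indicator₀ ?_ hset
    exact integrableOn_halfGammaKernel.comp_fst P
  have h1 : ∀ x ∈ Ioi (0 : ℝ), bepIntegrand P γ x = ∫ w, H (x, w) ∂P := by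
    intro x hx
    have hn : NullMeasurableSet (γ ⁻¹' Iic x) P := hγ.nullMeasurable measurableSet_Iic
    have : (fun w => H (x, w)) = (γ ⁻¹' Iic x).indicator fun _ => halfGammaKernel x := by
      ext w
      by_cases h : γ w ≤ x <;> simp [H, h]
    rw [this, integral_indicator₀ hn, setIntegral_const, bepIntegrand, cdf_eq_real,
      map_measureReal_apply_of_aemeasurable hγ measurableSet_Iic, mul_assoc]
    rfl
  rw [setIntegral_congr_fun measurableSet_Ioi h1,
    integral_integral_swap (f := fun x w => H (x, w)) hInt]
  refine integral_congr_ae ?_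
  filter_upwards [hpos] with w hw
  have : (fun x => H (x, w)) = (Ici (γ w)).indicator halfGammaKernel := by
    ext x
    by_cases h : γ w ≤ x <;> simp [H, h]
  rw [this, integral_indicator measurableSet_Ici, Measure.restrict_restrict measurableSet_Ici,
    inter_eq_left.2 (Ici_subset_Ioi.2 hw), integral_Ici_eq_integral_Ioi]
  rfl

omit [IsProbabilityMeasure P] in
theorem bepBPSK_eq_integral_halfGammaTail (hpos : ∀ᵐ w ∂P, 0 < γ w) :
    bepBPSK P γ = (2 * √Real.pi)⁻¹ * ∫ w, halfGammaTail (γ w) ∂P := by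
  rw [bepBPSK, ← integral_const_mul]
  refine integral_congr_ae ?_
  filter_upwards [hpos] with w hw using gaussianQ_sqrt_two_mul hw.le

/-! ### From moments to the Mellin--Barnes integral -/

/-- The Mellin--Barnes representation of `E[Γ(1/2, γ)]` in terms of the moments of `γ`. -/
theorem mellinBarnes_halfGammaTail (hγ : AEMeasurable γ P) (hpos : ∀ᵐ w ∂P, 0 < γ w) {c : ℝ}
    (hc : 0 < c) {M : ℝ → ℂ}
    (hM : ∀ t : ℝ, HasComplexMoment P γ (-(c + t * I)) (M t)) :
    Integrable (fun t : ℝ => Gamma (c + t * I + 1 / 2) / (c + t * I) * M t) ∧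
      (1 / (2 * Real.pi) : ℂ) * ∫ t : ℝ, Gamma (c + t * I + 1 / 2) / (c + t * I) * M t =
        ((∫ w, halfGammaTail (γ w) ∂P : ℝ) : ℂ) := by
  set K : ℝ → ℂ := fun t => Gamma (c + t * I + 1 / 2) / (c + t * I) with hK
  have hKint : Integrable K := verticalIntegrable_Gamma_add_half_div hc
  let H : W × ℝ → ℂ := fun p => K p.2 * (γ p.1 : ℂ) ^ (-(c + p.2 * I) : ℂ)
  have hInt : Integrable H (P.prod volume) := by
    -- As `|γ^(-(c + tI))| = γ^(-c)` does not depend on `t`, the moment at `t = 0` times `K`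
    -- dominates.
    refine ((hM 0).integrable.mul_prod hKint).mono ?_ ?_
    · refine hKint.1.comp_snd.mul (AEMeasurable.aestronglyMeasurable ?_)
      have : AEMeasurable (fun p : W × ℝ => γ p.1) (P.prod volume) := hγ.comp_fst
      fun_prop
    · have : ∀ᵐ p ∂(P.prod (volume : Measure ℝ)), 0 < γ p.1 :=
        Measure.quasiMeasurePreserving_fst.ae hpos
      filter_upwards [this] with p hp
      simp only [H, norm_mul, norm_cpow_eq_rpow_re_of_pos hp]
      simp [mul_comm]
  have h1 : ∀ t : ℝ, ∫ w, H (w, t) ∂P = K t * M t := by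
    intro t
    simp only [H]
    rw [integral_const_mul, (hM t).integral_eq]
  have h2 := hInt.integral_prod_right
  simp only [h1] at h2
  refine ⟨h2, ?_⟩
  have h3 : ∫ t, K t * M t = ∫ w, (∫ t, H (w, t)) ∂P := by
    rw [integral_integral_swap (f := fun w t => H (w, t)) hInt]
    simp only [h1]
  rw [h3, ← integral_const_mul, ← integral_complex_ofReal]
  refine integral_congr_ae ?_
  filter_upwards [hpos] with w hw using integral_Gamma_add_half_div_mul_cpow hc hw

end

section
variable {W : Type*} [MeasurableSpace W] {P : Measure W} [IsProbabilityMeasure P] {γ : W → ℝ}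

/-- The bit error probability is a G-function as soon as the moments of the SNR are, up to a
constant, the corresponding quotient of gamma factors. -/
theorem bepBPSK_eq_meijerG (hγ : AEMeasurable γ P) (hpos : ∀ᵐ w ∂P, 0 < γ w) {m n : ℕ}
    {a b : List ℂ} {z : ℂ} {S : ℝ} (hS : S ≠ 0) (hex : ∃ c, MeijerSeparates m n a b c)
    (hsep : ∀ c, MeijerSeparates m n a b c → 0 < c)
    (hM : ∀ c, MeijerSeparates m n a b c → ∀ t : ℝ, ∃ M,
      HasComplexMoment P γ (-(c + t * I)) M ∧
      Gamma (c + t * I + 1 / 2) / (c + t * I) * M = S * meijerIntegrand m n a b z (c + t * I)) :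
    IntegrableOn (bepIntegrand P γ) (Ioi 0) ∧
    bepBPSK P γ = (2 * √Real.pi)⁻¹ * ∫ x in Ioi (0 : ℝ), bepIntegrand P γ x ∧
    (∃ G : ℂ, HasMeijerG m n a b z G) ∧
    (bepBPSK P γ : ℂ) = (S : ℂ) * (((2 * √Real.pi)⁻¹ : ℝ) : ℂ) * meijerG m n a b z := by
  have hS' : (S : ℂ) ≠ 0 := by exact_mod_cast hS
  have hG : HasMeijerG m n a b z ((S : ℂ)⁻¹ * ((∫ w, halfGammaTail (γ w) ∂P : ℝ) : ℂ)) := by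
    -- The expectation on the right does not involve `c`, which gives the common value along all
    -- separating lines.
    have key := fun c (hc : MeijerSeparates m n a b c) => by
      choose M hM1 hM2 using hM c hc
      have := mellinBarnes_halfGammaTail hγ hpos (hsep c hc) hM1
      simp only [hM2] at this
      exact this
    refine ⟨hex, fun c hc => ?_, fun c hc => ?_⟩
    · exact ((key c hc).1.const_mul (S : ℂ)⁻¹).congr
        (.of_forall fun t => by simp only [inv_mul_cancel_left₀ hS'])
    · rw [← (key c hc).2, integral_const_mul, mul_left_comm _ (S : ℂ),
        inv_mul_cancel_left₀ hS']
  refine ⟨integrableOn_bepIntegrand hγ, ?_, ⟨_, hG⟩, ?_⟩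
  · rw [integral_bepIntegrand hγ hpos, bepBPSK_eq_integral_halfGammaTail hpos]
  · rw [hG.meijerG_eq, bepBPSK_eq_integral_halfGammaTail hpos]
    push_cast
    field_simp

end

/-! ### The two Meijer integrands and their separating lines -/

theorem cpow_mul_of_pos {x y : ℝ} (hx : 0 < x) (hy : 0 < y) (s : ℂ) :
    ((x * y : ℝ) : ℂ) ^ s = (x : ℂ) ^ s * (y : ℂ) ^ s := by
  rw [ofReal_mul, mul_cpow_ofReal_nonneg hx.le hy.le]

section
variable {m₁ m₂ : ℝ}

/-- Only the first pole of each family matters. On the left these are `-α₂`, `-α₁`, `0` and `-1/2`,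
so the upper parameter `1` alone decides. -/
theorem meijerSeparates_doubleShadowing_iff {α₁ α₂ c : ℝ} (hα₁ : 1 < α₁) (hα₂ : 1 < α₂) :
    MeijerSeparates 2 4 [1 - (α₂ : ℂ), 1 - (α₁ : ℂ), 1, 1 / 2] [(m₁ : ℂ), (m₂ : ℂ), 0] c ↔
      0 < c ∧ c < m₁ ∧ c < m₂ := by
  simp only [MeijerSeparates, List.take, List.forall_mem_cons, List.not_mem_nil, false_implies,
    implies_true, and_true]
  constructor
  · rintro ⟨⟨h1, h2⟩, -, -, h3, -⟩
    have h1 := h1 0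
    have h2 := h2 0
    have h3 := h3 0
    simp at h1 h2 h3
    exact ⟨h3, h1, h2⟩
  · rintro ⟨h0, h1, h2⟩
    refine ⟨⟨fun k => ?_, fun k => ?_⟩, fun k => ?_, fun k => ?_, fun k => ?_, fun k => ?_⟩ <;>
    · have hk : (0 : ℝ) ≤ k := k.cast_nonneg
      norm_num
      linarith

theorem meijerSeparates_singleShadowing_iff {α c : ℝ} (hα : 1 < α) :
    MeijerSeparates 2 3 [1 - (α : ℂ), 1, 1 / 2] [(m₁ : ℂ), (m₂ : ℂ), 0] c ↔
      0 < c ∧ c < m₁ ∧ c < m₂ := by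
  simp only [MeijerSeparates, List.take, List.forall_mem_cons, List.not_mem_nil, false_implies,
    implies_true, and_true]
  constructor
  · rintro ⟨⟨h1, h2⟩, -, h3, -⟩
    have h1 := h1 0
    have h2 := h2 0
    have h3 := h3 0
    simp at h1 h2 h3
    exact ⟨h3, h1, h2⟩
  · rintro ⟨h0, h1, h2⟩
    refine ⟨⟨fun k => ?_, fun k => ?_⟩, fun k => ?_, fun k => ?_, fun k => ?_⟩ <;>
    · have hk : (0 : ℝ) ≤ k := k.cast_nonneg
      norm_num
      linarith

/-- The upper parameter `1` and the lower parameter `0` together give `Γ(s) / Γ(1 + s) = 1 / s`; the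
upper parameter `1/2` gives `Γ(s + 1/2)`. -/
theorem meijerIntegrand_doubleShadowing {α₁ α₂ : ℝ} {z s : ℂ} (hs : 0 < s.re) :
    meijerIntegrand 2 4 [1 - (α₂ : ℂ), 1 - (α₁ : ℂ), 1, 1 / 2] [(m₁ : ℂ), (m₂ : ℂ), 0] z s =
      Gamma (s + 1 / 2) / s * (Gamma (m₁ - s) * Gamma (m₂ - s) * Gamma (α₁ + s) * Gamma (α₂ + s))
        * z ^ s := by
  have hs0 : s ≠ 0 := by rintro rfl; simp at hs
  have hG := Gamma_ne_zero_of_re_pos hs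
  have h : Gamma (1 + s) = s * Gamma s := by rw [add_comm, Gamma_add_one _ hs0]
  have h2 : (1 - 1 / 2 + s : ℂ) = s + 1 / 2 := by ring
  simp only [meijerIntegrand, List.take, List.drop, List.map, List.prod_cons, List.prod_nil,
    sub_sub_cancel, sub_self, sub_zero, zero_add, h, h2]
  field_simp

theorem meijerIntegrand_singleShadowing {α : ℝ} {z s : ℂ} (hs : 0 < s.re) :
    meijerIntegrand 2 3 [1 - (α : ℂ), 1, 1 / 2] [(m₁ : ℂ), (m₂ : ℂ), 0] z s =
      Gamma (s + 1 / 2) / s * (Gamma (m₁ - s) * Gamma (m₂ - s) * Gamma (α + s)) * z ^ s := by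
  have hs0 : s ≠ 0 := by rintro rfl; simp at hs
  have hG := Gamma_ne_zero_of_re_pos hs
  have h : Gamma (1 + s) = s * Gamma s := by rw [add_comm, Gamma_add_one _ hs0]
  have h2 : (1 - 1 / 2 + s : ℂ) = s + 1 / 2 := by ring
  simp only [meijerIntegrand, List.take, List.drop, List.map, List.prod_cons, List.prod_nil,
    sub_sub_cancel, sub_self, sub_zero, zero_add, h, h2]
  field_simp

end

/-! ### Moments of the two SNRs -/

section
variable {W : Type*} [MeasurableSpace W] {P : Measure W} {m₁ m₂ Ω : ℝ}

theorem DoubleShadowing.ae_pos {N₁ N₂ I₁ I₂ : W → ℝ} {α₁ α₂ g₁ g₂ : ℝ}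
    (h : DoubleShadowing P N₁ N₂ I₁ I₂ m₁ m₂ Ω α₁ α₂ g₁ g₂) :
    ∀ᵐ w ∂P, 0 < snrDS N₁ N₂ I₁ I₂ w := by
  filter_upwards [ae_pos_of_nakagamiPowerLaw h.law_N₁, ae_pos_of_nakagamiPowerLaw h.law_N₂,
    ae_pos_of_inverseGammaLaw h.law_I₁, ae_pos_of_inverseGammaLaw h.law_I₂] with w h1 h2 h3 h4
  exact mul_pos (mul_pos h1 h3) (mul_pos h2 h4)

theorem SingleShadowing.ae_pos {N₁ N₂ I : W → ℝ} {α g : ℝ}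
    (h : SingleShadowing P N₁ N₂ I m₁ m₂ Ω α g) : ∀ᵐ w ∂P, 0 < snrSS N₁ N₂ I w := by
  filter_upwards [ae_pos_of_nakagamiPowerLaw h.law_N₁, ae_pos_of_nakagamiPowerLaw h.law_N₂,
    ae_pos_of_inverseGammaLaw h.law_I] with w h1 h2 h3
  rw [snrSS, mul_pow]
  exact mul_pos (mul_pos h1 h2) h3

theorem DoubleShadowing.aemeasurable {N₁ N₂ I₁ I₂ : W → ℝ} {α₁ α₂ g₁ g₂ : ℝ}
    (h : DoubleShadowing P N₁ N₂ I₁ I₂ m₁ m₂ Ω α₁ α₂ g₁ g₂) :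
    AEMeasurable (snrDS N₁ N₂ I₁ I₂) P :=
  ((h.aemeasurable_N₁.pow_const 2).mul h.law_I₁.aemeasurable).mul
    ((h.aemeasurable_N₂.pow_const 2).mul h.law_I₂.aemeasurable)

theorem SingleShadowing.aemeasurable {N₁ N₂ I : W → ℝ} {α g : ℝ}
    (h : SingleShadowing P N₁ N₂ I m₁ m₂ Ω α g) : AEMeasurable (snrSS N₁ N₂ I) P :=
  ((h.aemeasurable_N₁.mul h.aemeasurable_N₂).pow_const 2).mul h.law_I.aemeasurable

theorem DoubleShadowing.hasComplexMoment {N₁ N₂ I₁ I₂ : W → ℝ} {α₁ α₂ g₁ g₂ : ℝ}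
    (h : DoubleShadowing P N₁ N₂ I₁ I₂ m₁ m₂ Ω α₁ α₂ g₁ g₂) (hm₁ : 0 < m₁) (hm₂ : 0 < m₂)
    (hΩ : 0 < Ω) (hα₁ : 0 < α₁) (hα₂ : 0 < α₂) (hg₁ : 0 < g₁) (hg₂ : 0 < g₂) {s : ℂ}
    (hs : 0 < s.re) (hs₁ : s.re < m₁) (hs₂ : s.re < m₂) :
    HasComplexMoment P (snrDS N₁ N₂ I₁ I₂) (-s)
      (((1 / (Real.Gamma m₁ * Real.Gamma m₂ * Real.Gamma α₁ * Real.Gamma α₂) : ℝ) : ℂ)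
        * (Gamma (m₁ - s) * Gamma (m₂ - s) * Gamma (α₁ + s) * Gamma (α₂ + s))
        * ((m₁ * m₂ / (Ω ^ 2 * (g₁ * g₂)) : ℝ) : ℂ) ^ s) := by
  have hp1 := ae_pos_of_nakagamiPowerLaw h.law_N₁
  have hp2 := ae_pos_of_nakagamiPowerLaw h.law_N₂
  have hp3 := ae_pos_of_inverseGammaLaw h.law_I₁
  have hp4 := ae_pos_of_inverseGammaLaw h.law_I₂
  have hind : iIndepFun ![fun w => N₁ w ^ 2, fun w => N₂ w ^ 2, I₁, I₂] P := by
    have := h.indep.comp ![fun x => x ^ 2, fun x => x ^ 2, id, id]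
      (by simp only [Fin.forall_fin_succ]
          exact ⟨measurable_id.pow_const 2, measurable_id.pow_const 2, measurable_id, measurable_id,
            fun i => i.elim0⟩)
    convert this using 1
    ext i w
    fin_cases i <;> rfl
  have hmeas : ∀ i, AEMeasurable (![fun w => N₁ w ^ 2, fun w => N₂ w ^ 2, I₁, I₂] i) P := by
    simp only [Fin.forall_fin_succ]
    exact ⟨h.law_N₁.aemeasurable, h.law_N₂.aemeasurable, h.law_I₁.aemeasurable,
      h.law_I₂.aemeasurable, fun i => i.elim0⟩
  have i13 : IndepFun (fun w => N₁ w ^ 2) I₁ P := hind.indepFun (i := 0) (j := 2) (by decide)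
  have i24 : IndepFun (fun w => N₂ w ^ 2) I₂ P := hind.indepFun (i := 1) (j := 3) (by decide)
  have ipair : IndepFun ((fun w => N₁ w ^ 2) * I₁) ((fun w => N₂ w ^ 2) * I₂) P :=
    hind.indepFun_mul_mul₀ hmeas 0 2 1 3 (by decide) (by decide) (by decide) (by decide)
  refine (((hasComplexMoment_nakagamiPowerLaw hm₁ hΩ h.law_N₁ hs₁).mul
    (hasComplexMoment_inverseGammaLaw hα₁ hg₁ h.law_I₁ (by linarith)) hp1 hp3 i13).mul
    ((hasComplexMoment_nakagamiPowerLaw hm₂ hΩ h.law_N₂ hs₂).mul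
    (hasComplexMoment_inverseGammaLaw hα₂ hg₂ h.law_I₂ (by linarith)) hp2 hp4 i24)
    (by filter_upwards [hp1, hp3] with w a b using mul_pos a b)
    (by filter_upwards [hp2, hp4] with w a b using mul_pos a b) ipair).congr rfl ?_
  -- The argument of the G-function is the product of the four positive scales, each raised to `s`
  -- in its own moment.
  rw [show m₁ * m₂ / (Ω ^ 2 * (g₁ * g₂)) = (m₁ / Ω * g₁⁻¹) * (m₂ / Ω * g₂⁻¹) by field_simp,
    cpow_mul_of_pos (by positivity) (by positivity), cpow_mul_of_pos (by positivity) (by positivity),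
    cpow_mul_of_pos (by positivity) (by positivity)]
  push_cast
  ring

theorem SingleShadowing.hasComplexMoment {N₁ N₂ I : W → ℝ} {α g : ℝ}
    (h : SingleShadowing P N₁ N₂ I m₁ m₂ Ω α g) (hm₁ : 0 < m₁) (hm₂ : 0 < m₂)
    (hΩ : 0 < Ω) (hα : 0 < α) (hg : 0 < g) {s : ℂ}
    (hs : 0 < s.re) (hs₁ : s.re < m₁) (hs₂ : s.re < m₂) :
    HasComplexMoment P (snrSS N₁ N₂ I) (-s)
      (((1 / (Real.Gamma m₁ * Real.Gamma m₂ * Real.Gamma α) : ℝ) : ℂ)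
        * (Gamma (m₁ - s) * Gamma (m₂ - s) * Gamma (α + s))
        * ((m₁ * m₂ / (Ω ^ 2 * g) : ℝ) : ℂ) ^ s) := by
  have hp1 := ae_pos_of_nakagamiPowerLaw h.law_N₁
  have hp2 := ae_pos_of_nakagamiPowerLaw h.law_N₂
  have hp3 := ae_pos_of_inverseGammaLaw h.law_I
  have hind : iIndepFun ![fun w => N₁ w ^ 2, fun w => N₂ w ^ 2, I] P := by
    have := h.indep.comp ![fun x => x ^ 2, fun x => x ^ 2, id]
      (by simp only [Fin.forall_fin_succ]
          exact ⟨measurable_id.pow_const 2, measurable_id.pow_const 2, measurable_id,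
            fun i => i.elim0⟩)
    convert this using 1
    ext i w
    fin_cases i <;> rfl
  have hmeas : ∀ i, AEMeasurable (![fun w => N₁ w ^ 2, fun w => N₂ w ^ 2, I] i) P := by
    simp only [Fin.forall_fin_succ]
    exact ⟨h.law_N₁.aemeasurable, h.law_N₂.aemeasurable, h.law_I.aemeasurable,
      fun i => i.elim0⟩
  have i12 : IndepFun (fun w => N₁ w ^ 2) (fun w => N₂ w ^ 2) P :=
    hind.indepFun (i := 0) (j := 1) (by decide)
  have ipair : IndepFun ((fun w => N₁ w ^ 2) * (fun w => N₂ w ^ 2)) I P :=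
    hind.indepFun_mul_left₀ hmeas 0 1 2 (by decide) (by decide)
  refine (((hasComplexMoment_nakagamiPowerLaw hm₁ hΩ h.law_N₁ hs₁).mul
    (hasComplexMoment_nakagamiPowerLaw hm₂ hΩ h.law_N₂ hs₂) hp1 hp2 i12).mul
    (hasComplexMoment_inverseGammaLaw hα hg h.law_I (by linarith))
    (by filter_upwards [hp1, hp2] with w a b using mul_pos a b) hp3 ipair).congr ?_ ?_
  · ext w
    simp [snrSS, mul_pow]
  · rw [show m₁ * m₂ / (Ω ^ 2 * g) = (m₁ / Ω) * (m₂ / Ω) * g⁻¹ by field_simp,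
      cpow_mul_of_pos (by positivity) (by positivity),
      cpow_mul_of_pos (by positivity) (by positivity)]
    push_cast
    ring

end
end

/-! ### The bit error probabilities -/

theorem mainTheorem5 {W : Type*} [MeasurableSpace W] (P : Measure W) [IsProbabilityMeasure P]
    (m₁ m₂ Ω : ℝ) (hm₁ : 0 < m₁) (hm₂ : 0 < m₂) (hΩ : 0 < Ω) :
    -- double shadowing
    (∀ (α₁ α₂ g₁ g₂ : ℝ), 1 < α₁ → 1 < α₂ → 0 < g₁ → 0 < g₂ →
      ∀ N₁ N₂ I₁ I₂ : W → ℝ, DoubleShadowing P N₁ N₂ I₁ I₂ m₁ m₂ Ω α₁ α₂ g₁ g₂ →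
      IntegrableOn (bepIntegrand P (snrDS N₁ N₂ I₁ I₂)) (Set.Ioi 0) ∧
      bepBPSK P (snrDS N₁ N₂ I₁ I₂) =
        (2 * √Real.pi)⁻¹ * ∫ x in Set.Ioi (0 : ℝ), bepIntegrand P (snrDS N₁ N₂ I₁ I₂) x ∧
      (∃ G : ℂ, HasMeijerG 2 4 [1 - (α₂ : ℂ), 1 - (α₁ : ℂ), 1, 1 / 2] [(m₁ : ℂ), (m₂ : ℂ), 0]
        ((m₁ * m₂ / (Ω ^ 2 * (g₁ * g₂)) : ℝ) : ℂ) G) ∧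
      (bepBPSK P (snrDS N₁ N₂ I₁ I₂) : ℂ) =
        ((1 / (Real.Gamma m₁ * Real.Gamma m₂ * Real.Gamma α₁ * Real.Gamma α₂) : ℝ) : ℂ)
          * (((2 * √Real.pi)⁻¹ : ℝ) : ℂ)
          * meijerG 2 4 [1 - (α₂ : ℂ), 1 - (α₁ : ℂ), 1, 1 / 2] [(m₁ : ℂ), (m₂ : ℂ), 0]
              ((m₁ * m₂ / (Ω ^ 2 * (g₁ * g₂)) : ℝ) : ℂ)) ∧
    -- single shadowing
    (∀ (α g : ℝ), 1 < α → 0 < g →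
      ∀ N₁ N₂ I : W → ℝ, SingleShadowing P N₁ N₂ I m₁ m₂ Ω α g →
      IntegrableOn (bepIntegrand P (snrSS N₁ N₂ I)) (Set.Ioi 0) ∧
      bepBPSK P (snrSS N₁ N₂ I) =
        (2 * √Real.pi)⁻¹ * ∫ x in Set.Ioi (0 : ℝ), bepIntegrand P (snrSS N₁ N₂ I) x ∧
      (∃ G : ℂ, HasMeijerG 2 3 [1 - (α : ℂ), 1, 1 / 2] [(m₁ : ℂ), (m₂ : ℂ), 0]
        ((m₁ * m₂ / (Ω ^ 2 * g) : ℝ) : ℂ) G) ∧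
      (bepBPSK P (snrSS N₁ N₂ I) : ℂ) =
        ((1 / (Real.Gamma m₁ * Real.Gamma m₂ * Real.Gamma α) : ℝ) : ℂ)
          * (((2 * √Real.pi)⁻¹ : ℝ) : ℂ)
          * meijerG 2 3 [1 - (α : ℂ), 1, 1 / 2] [(m₁ : ℂ), (m₂ : ℂ), 0]
              ((m₁ * m₂ / (Ω ^ 2 * g) : ℝ) : ℂ)) := by
  -- The midpoint of the strip `0 < c < min(m₁, m₂)` serves as a separating line in both scenarios.
  have hex : ∃ c : ℝ, 0 < c ∧ c < m₁ ∧ c < m₂ :=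
    ⟨min m₁ m₂ / 2, by positivity, by linarith [min_le_left m₁ m₂, lt_min hm₁ hm₂],
      by linarith [min_le_right m₁ m₂, lt_min hm₁ hm₂]⟩
  refine ⟨fun α₁ α₂ g₁ g₂ hα₁ hα₂ hg₁ hg₂ N₁ N₂ I₁ I₂ h => ?_, fun α g hα hg N₁ N₂ I h => ?_⟩
  · have hα₁' : 0 < α₁ := by linarith
    have hα₂' : 0 < α₂ := by linarith
    refine bepBPSK_eq_meijerG h.aemeasurable h.ae_pos ?_ ?_ (fun c hc => ?_) fun c hc t => ?_
    · have := Real.Gamma_pos_of_pos hm₁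
      have := Real.Gamma_pos_of_pos hm₂
      have := Real.Gamma_pos_of_pos hα₁'
      have := Real.Gamma_pos_of_pos hα₂'
      positivity
    · simpa only [meijerSeparates_doubleShadowing_iff hα₁ hα₂] using hex
    · exact ((meijerSeparates_doubleShadowing_iff hα₁ hα₂).1 hc).1
    · obtain ⟨h0, h1, h2⟩ := (meijerSeparates_doubleShadowing_iff hα₁ hα₂).1 hc
      refine ⟨_, h.hasComplexMoment hm₁ hm₂ hΩ hα₁' hα₂' hg₁ hg₂ (by simpa using h0)
        (by simpa using h1) (by simpa using h2), ?_⟩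
      rw [meijerIntegrand_doubleShadowing (by simpa using h0)]
      ring
  · have hα' : 0 < α := by linarith
    refine bepBPSK_eq_meijerG h.aemeasurable h.ae_pos ?_ ?_ (fun c hc => ?_) fun c hc t => ?_
    · have := Real.Gamma_pos_of_pos hm₁
      have := Real.Gamma_pos_of_pos hm₂
      have := Real.Gamma_pos_of_pos hα'
      positivity
    · simpa only [meijerSeparates_singleShadowing_iff hα] using hex
    · exact ((meijerSeparates_singleShadowing_iff hα).1 hc).1
    · obtain ⟨h0, h1, h2⟩ := (meijerSeparates_singleShadowing_iff hα).1 hc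
      refine ⟨_, h.hasComplexMoment hm₁ hm₂ hΩ hα' hg (by simpa using h0)
        (by simpa using h1) (by simpa using h2), ?_⟩
      rw [meijerIntegrand_singleShadowing (by simpa using h0)]
      ring
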